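/- Fix an integer $d\ge 1$ and set $D=\binom{d+1}{2}$. Let $G=(V,E)$ be a finite graph (parallel edges and loops are allowed) and let $R$ be a finite multiset of vertices of $G$, whose elements (copies of vertices) are regarded as distinct. For $v\in V$ let $R_v$ be the multiset of the elements of $R$ that are copies of $v$. For $F\subseteq E$ let $V(F)$ be the set of vertices incident to some edge of $F$, and let $R_F$ be the multiset of the elements of $R$ that are copies of vertices in $V(F)$. Let $Gr(2,\mathbb R^{d+1})$ be the set of $2$-dimensional linear subspaces of $\mathbb R^{d+1}$, regarded via the Plücker embedding $\mathrm{span}(x,y)\mapsto[x\wedge y]$ as a subset of $\mathbb P(\bigwedge^2\mathbb R^{d+1})$. For maps $b:E\to Gr(2,\mathbb R^{d+1})$ (a bar-configuration) and $b^\circ:R\to Gr(2,\mathbb R^{d+1})$ (a bar-boundary), let $b_e$ and $b^\circ_r$ in $\bigwedge^2\mathbb R^{d+1}$ be representatives of $b(e)$ and $b^\circ(r)$. For $a\in\bigwedge^{d-1}\mathbb R^{d+1}$ and $c\in\bigwedge^2\mathbb R^{d+1}$ write $\langle a,c\rangle$ for the Euclidean inner product of $a$ and the Hodge dual $\ast c$.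 An infinitesimal motion of the body-bar framework with bar-boundary $(G,R;b,b^\circ)$ is a map $m:V\to\bigwedge^{d-1}\mathbb R^{d+1}$ such that $\langle m(u)-m(v),b_e\rangle=0$ for every edge $e=uv\in E$, and $\langle m(v),b^\circ_r\rangle=0$ for every $v\in V$ and $r\in R_v$. The framework is infinitesimally rigid if its only infinitesimal motion is $m=0$. It is minimally infinitesimally rigid if it is infinitesimally rigid and the removal of any single bar $e\in E$ or boundary-bar $r\in R$ results in a framework that is not infinitesimally rigid. **Theorem.** Let $b^\circ:R\to Gr(2,\mathbb R^{d+1})$ be given. There exists a bar-configuration $b:E\to Gr(2,\mathbb R^{d+1})$ such that $(G,R;b,b^\circ)$ is minimally infinitesimally rigid if and only if the following three conditions hold: 1. for each $v\in V$, the family $(b^\circ_r)_{r\in R_v}$ is linearly independent; 2. for every non-empty $F\subseteq E$, $|F|+|R_F|\le D|V(F)|-D+\dim\operatorname{span}\{b^\circ_r\mid r\in R_F\}$; 3. $|E|+|R|=D|V|$. -/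

import Mathlib

open scoped Graph

noncomputable section

namespace BodyBar

/-- The Euclidean space `ℝⁿ`. -/
abbrev Vec (n : ℕ) : Type := EuclideanSpace ℝ (Fin n)

/-- The standard basis `e_S = e_{i₁} ∧ ⋯ ∧ e_{iₖ}` (`S = {i₁ < ⋯ < iₖ}`) of `⋀ᵏ ℝⁿ`, which is
orthonormal for the standard Euclidean inner product. -/
def extBasis (n k : ℕ) :
    OrthonormalBasis (Set.powersetCard (Fin n) k) ℝ (⋀[ℝ]^k (Vec n)) :=
  (EuclideanSpace.basisFun (Fin n) ℝ).exteriorPower k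

/-- The complement of a `k`-element subset of `{1, …, n}`. -/
def complIndex {n k : ℕ} (S : Set.powersetCard (Fin n) k) : Set.powersetCard (Fin n) (n - k) :=
  Set.powersetCard.ofCard (s := (S : Finset (Fin n))ᶜ) (by
    rw [Finset.card_compl, Fintype.card_fin, Set.powersetCard.card_eq])

/-- The sign `ε` with `e_S ∧ e_{Sᶜ} = ε • (e₁ ∧ ⋯ ∧ eₙ)`: the parity of the number of pairs
`(i, j)` with `i ∈ S`, `j ∉ S` and `j < i`. -/
def complSign {n k : ℕ} (S : Set.powersetCard (Fin n) k) : ℝ :=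
  (-1) ^ (((S : Finset (Fin n)) ×ˢ (S : Finset (Fin n))ᶜ).filter (fun p => p.2 < p.1)).card

/-- The Hodge star `⋀ᵏ ℝⁿ → ⋀ⁿ⁻ᵏ ℝⁿ`, `e_S ↦ ε(S) e_{Sᶜ}`. -/
def hodgeStar (n k : ℕ) : (⋀[ℝ]^k (Vec n)) →ₗ[ℝ] (⋀[ℝ]^(n - k) (Vec n)) :=
  (extBasis n k).toBasis.constr ℝ (fun S => complSign S • extBasis n (n - k) (complIndex S))

/-- The space `⋀^{d-1} ℝ^{d+1}` of infinitesimal motions of one body in dimension `d ≥ 1`. -/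
abbrev Screw (d : ℕ) : Type := ⋀[ℝ]^(d - 1) (Vec (d + 1))

/-- The pairing `⟨a, b⟩ = ⟨a, ⋆b⟩` of `a ∈ ⋀^{d-1} ℝ^{d+1}` and `b ∈ ⋀² ℝ^{d+1}`. -/
def pairing {d : ℕ} (a : Screw d) (b : ⋀[ℝ]^2 (Vec (d + 1))) : ℝ :=
  inner ℝ a (hodgeStar (d + 1) 2 b : Screw d)

/-- The Grassmannian `Gr(k, ℝⁿ)` of `k`-dimensional linear subspaces of `ℝⁿ`. -/
abbrev Gr (k n : ℕ) : Type := {W : Submodule ℝ (Vec n) // Module.finrank ℝ W = k}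

/-- A basis of a member of the Grassmannian. -/
def Gr.basis {k n : ℕ} (W : Gr k n) : Module.Basis (Fin k) ℝ W.1 :=
  Module.finBasisOfFinrankEq ℝ W.1 W.2

theorem wedge_ne_zero {k n : ℕ} {v : Fin k → Vec n} (hv : LinearIndependent ℝ v) :
    exteriorPower.ιMulti ℝ k v ≠ 0 := by
  have h := (exteriorPower.ιMulti_family_linearIndependent_field (n := k) hv).ne_zero
    (Set.powersetCard.ofFinEmbEquiv (RelEmbedding.refl _))
  rw [exteriorPower.ιMulti_family, Equiv.symm_apply_apply] at h
  exact h

/-- The Plücker embedding `Gr(k, ℝⁿ) → ℙ(⋀ᵏ ℝⁿ)`, `W ↦ [v₁ ∧ ⋯ ∧ vₖ]` for a basis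
`v₁, …, vₖ` of `W`. -/
def plucker {k n : ℕ} (W : Gr k n) : Projectivization ℝ (⋀[ℝ]^k (Vec n)) :=
  Projectivization.mk ℝ (exteriorPower.ιMulti ℝ k (fun i => (W.basis i : Vec n)))
    (wedge_ne_zero (W.basis.linearIndependent.map' W.1.subtype W.1.ker_subtype))

/-- The Plücker embedding does not depend on the choice of a basis. -/
theorem plucker_eq {k n : ℕ} (W : Gr k n) {v : Fin k → Vec n} (hv : LinearIndependent ℝ v)
    (hW : Submodule.span ℝ (Set.range v) = W.1) :
    plucker W = Projectivization.mk ℝ (exteriorPower.ιMulti ℝ k v) (wedge_ne_zero hv) := by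
  have hmem : ∀ i, v i ∈ W.1 := fun i => hW ▸ Submodule.subset_span (Set.mem_range_self i)
  have key : (exteriorPower.ιMulti ℝ k).compLinearMap W.1.subtype =
      (LinearMap.toSpanSingleton ℝ _ (exteriorPower.ιMulti ℝ k
        (fun i => (W.basis i : Vec n)))).compAlternatingMap W.basis.det := by
    refine Module.Basis.ext_alternating W.basis fun f hf => ?_
    obtain ⟨σ, rfl⟩ : ∃ σ : Equiv.Perm (Fin k), ⇑σ = f :=
      ⟨Equiv.ofBijective f (Finite.injective_iff_bijective.mp hf), rfl⟩
    change (exteriorPower.ιMulti ℝ k).compLinearMap W.1.subtype (W.basis ∘ σ) =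
      W.basis.det (W.basis ∘ σ) • exteriorPower.ιMulti ℝ k (fun i => (W.basis i : Vec n))
    rw [AlternatingMap.map_perm, AlternatingMap.map_perm, W.basis.det_self]
    simp only [Units.smul_def, ← Int.cast_smul_eq_zsmul ℝ, smul_eq_mul, mul_one]
    rfl
  refine (Projectivization.mk_eq_mk_iff' ..).mpr
    ⟨(W.basis.det fun i => (⟨v i, hmem i⟩ : W.1))⁻¹, ?_⟩
  have h := congr($key fun i => (⟨v i, hmem i⟩ : W.1))
  have h' : exteriorPower.ιMulti ℝ k v = (W.basis.det fun i => (⟨v i, hmem i⟩ : W.1)) •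
    exteriorPower.ιMulti ℝ k (fun i => (W.basis i : Vec n)) := h
  have h0 : (W.basis.det fun i => (⟨v i, hmem i⟩ : W.1)) ≠ 0 := by
    intro h0
    rw [h0, zero_smul] at h'
    exact wedge_ne_zero hv h'
  rw [h', inv_smul_smul₀ h0]

/-- A homogeneous Plücker coordinate vector of a member of the Grassmannian, i.e. a representative
of its image under the Plücker embedding. Another representative differs by a nonzero factor, which
changes neither the vanishing of a pairing, nor linear independence, nor a span. -/
def pluckerVec {k n : ℕ} (W : Gr k n) : ⋀[ℝ]^k (Vec n) := (plucker W).rep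

/-- A `d`-dimensional body-bar framework with bar-boundary. The underlying graph is a multigraph;
`ρ` indexes the elements of the multiset `R` of vertices, `root r` being the vertex that the
element `r` is a copy of. -/
structure Framework (d : ℕ) (α β ρ : Type*) where
  /-- the underlying graph -/
  graph : Graph α β
  /-- the multiset of vertices, as an indexed family -/
  root : ρ → V(graph)
  /-- the bar-configuration -/
  bar : E(graph) → Gr 2 (d + 1)
  /-- the configuration of the bar-boundary -/
  boundaryBar : ρ → Gr 2 (d + 1)

namespace Framework

variable {d : ℕ} {α β ρ : Type*} (P : Framework d α β ρ)

/-- Infinitesimal motions: the bar-constraints and the boundary-constraints. -/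
def IsInfinitesimalMotion (m : V(P.graph) → Screw d) : Prop :=
  (∀ (e : E(P.graph)) (u v : V(P.graph)), P.graph.IsLink e u v →
    pairing (m u - m v) (pluckerVec (P.bar e)) = 0) ∧
  ∀ r : ρ, pairing (m (P.root r)) (pluckerVec (P.boundaryBar r)) = 0

/-- There is no nonzero infinitesimal motion. -/
def IsInfinitesimallyRigid : Prop :=
  ∀ m : V(P.graph) → Screw d, P.IsInfinitesimalMotion m → m = 0

/-- The framework obtained by removing the bar `e`. -/
def removeBar (e : E(P.graph)) : Framework d α β ρ where
  graph := P.graph.deleteEdges {(e : β)}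
  root r := ⟨P.root r, (P.root r).2⟩
  bar f := P.bar ⟨f, f.2.1⟩
  boundaryBar := P.boundaryBar

/-- The framework obtained by removing the boundary-bar `r`. -/
def removeBoundaryBar (r : ρ) : Framework d α β {s : ρ // s ≠ r} where
  graph := P.graph
  root s := P.root s
  bar := P.bar
  boundaryBar s := P.boundaryBar s

/-- Infinitesimally rigid, and removing any bar or boundary-bar gives a framework that is not. -/
def IsMinimallyInfinitesimallyRigid : Prop :=
  P.IsInfinitesimallyRigid ∧
  (∀ e, ¬ (P.removeBar e).IsInfinitesimallyRigid) ∧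
  ∀ r, ¬ (P.removeBoundaryBar r).IsInfinitesimallyRigid

end Framework

/-- `V(F)`, the set of vertices incident to an edge of `F`. -/
def incidentVertices {α β : Type*} (G : Graph α β) (F : Set β) : Set α :=
  {v | ∃ e ∈ F, G.Inc e v}

/-- `R_F`, the (indices of the) elements of the multiset `R` that lie in `V(F)`. -/
def rootsOn {α β ρ : Type*} (G : Graph α β) (root : ρ → V(G)) (F : Set β) : Set ρ :=
  {r | (root r : α) ∈ incidentVertices G F}

end BodyBar

end

noncomputable section

namespace BodyBar

open Module

/-! Each bar or boundary-bar is a linear functional on the maps `V → Screw d`, a space of dimension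
`D|V|`. Minimal rigidity says exactly that these functionals form a basis of the dual
(`linearIndependent_and_card_eq_iff`): condition 3 together with independence.

Independence forces condition 2: the rows of `F` and `R_F` kill every map that is arbitrary off
`V(F)` and constant on `V(F)` with a value annihilated by the boundary functionals there
(`card_add_card_le_of_linearIndependent`).

Conversely, the row of an edge may be taken from a finite set of functionals of 2-planes spanning
the dual of `Screw d`, while boundary rows are fixed. Rado's theorem
(`exists_linearIndependent_transversal`) yields an independent choice once each subfamily of
candidates has large enough span. Offering all candidates at an edge identifies its ends, so the
span is computed component by component, and conditions 1 and 2 bound each component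
(`card_add_card_le_finrank`). -/

/-! ### Rado's theorem for vector spaces -/

/-- Elements are deleted while Hall's rank condition survives. If neither of two elements of one `A
i` can be deleted, modularity of dimension contradicts the condition. -/
theorem exists_linearIndependent_transversal {K M ι : Type*} [Field K] [AddCommGroup M]
    [Module K M] [FiniteDimensional K M] [Fintype ι] (A : ι → Finset M)
    (hA : ∀ I : Finset ι, I.card ≤ finrank K ↥(⨆ i ∈ I, Submodule.span K (A i : Set M))) :
    ∃ x : ι → M, (∀ i, x i ∈ A i) ∧ LinearIndependent K x := by
  classical
  induction hn : ∑ i, (A i).card using Nat.strong_induction_on generalizing A with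
  | _ n ih =>
  by_cases h1 : ∀ i, (A i).card = 1
  · choose x hx using fun i => Finset.card_eq_one.mp (h1 i)
    refine ⟨x, fun i => by simp [hx i], ?_⟩
    rw [linearIndependent_iff_card_le_finrank_span, Set.finrank]
    have h := hA Finset.univ
    rw [Finset.card_univ] at h
    exact h.trans (Submodule.finrank_mono (iSup₂_le fun i _ => Submodule.span_mono (by simp [hx i])))
  · push Not at h1
    obtain ⟨i, hi⟩ := h1
    have hpos : 1 ≤ (A i).card := by
      by_contra h0
      have h0 : A i = ∅ := by rw [← Finset.card_eq_zero]; omega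
      have := hA {i}
      simp [h0] at this
    obtain ⟨x, hx, y, hy, hxy⟩ := Finset.one_lt_card.mp (lt_of_le_of_ne hpos hi.symm)
    by_contra hno
    -- A subfamily violated by deleting `z` must contain `i`; here `I` is that subfamily without
    -- `i`.
    have key : ∀ z ∈ A i, ∃ I : Finset ι, i ∉ I ∧
        finrank K ↥(Submodule.span K ((A i).erase z : Set M) ⊔
          ⨆ j ∈ I, Submodule.span K (A j : Set M)) ≤ I.card := by
      intro z hz
      by_contra hc
      push Not at hc
      refine hno ?_
      have hlt : ∑ j, (Function.update A i ((A i).erase z) j).card < n := by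
        rw [← hn]
        refine Finset.sum_lt_sum (fun j _ => ?_) ⟨i, Finset.mem_univ i, ?_⟩
        · obtain rfl | hj := eq_or_ne j i
          · simpa using Finset.card_le_card (Finset.erase_subset z _)
          · simp [hj]
        · simpa using Finset.card_erase_lt_of_mem hz
      have hcond : ∀ I : Finset ι, I.card ≤ finrank K ↥(⨆ j ∈ I,
          Submodule.span K (Function.update A i ((A i).erase z) j : Set M)) := by
        intro I
        by_cases hiI : i ∈ I
        · have h := hc (I.erase i) (Finset.notMem_erase i I)
          rw [Finset.card_erase_of_mem hiI] at h
          refine (Nat.le_of_pred_lt h).trans (Submodule.finrank_mono (sup_le ?_ ?_))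
          · exact (by simp : _ ≤ _).trans (le_iSup₂_of_le i hiI le_rfl)
          · refine iSup₂_le fun j hj => ?_
            obtain ⟨hji, hj⟩ := Finset.mem_erase.mp hj
            exact (by simp [hji] : _ ≤ _).trans (le_iSup₂_of_le j hj le_rfl)
        · refine (hA I).trans (Submodule.finrank_mono (iSup₂_le fun j hj => ?_))
          have hji : j ≠ i := fun h => hiI (h ▸ hj)
          exact (by simp [hji] : _ ≤ _).trans (le_iSup₂_of_le j hj le_rfl)
      obtain ⟨w, hw, hwi⟩ := ih _ hlt _ hcond rfl
      refine ⟨w, fun j => ?_, hwi⟩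
      have := hw j
      obtain rfl | hj := eq_or_ne j i
      · simp only [Function.update_self] at this
        exact Finset.mem_of_mem_erase this
      · simpa [hj] using this
    obtain ⟨I, hiI, hI⟩ := key x hx
    obtain ⟨J, hiJ, hJ⟩ := key y hy
    set P := Submodule.span K ((A i).erase x : Set M) ⊔ ⨆ j ∈ I, Submodule.span K (A j : Set M)
    set Q := Submodule.span K ((A i).erase y : Set M) ⊔ ⨆ j ∈ J, Submodule.span K (A j : Set M)
    have hP : ∀ j ∈ I, Submodule.span K (A j : Set M) ≤ P := fun j hj =>
      le_sup_of_le_right (le_iSup₂_of_le j hj le_rfl)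
    have hQ : ∀ j ∈ J, Submodule.span K (A j : Set M) ≤ Q := fun j hj =>
      le_sup_of_le_right (le_iSup₂_of_le j hj le_rfl)
    -- As `x ≠ y`, every element of `A i` survives in one of the two erasures, so `P ⊔ Q` contains
    -- all of `A i`. This is the extra 1 that makes the final count contradictory.
    have hsup : (insert i (I ∪ J)).card ≤ finrank K ↥(P ⊔ Q) := by
      refine (hA _).trans (Submodule.finrank_mono (iSup₂_le fun j hj => ?_))
      rcases Finset.mem_insert.mp hj with rfl | hj
      · refine Submodule.span_le.mpr fun z hz => ?_
        by_cases hzx : z = x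
        · refine (le_sup_of_le_right le_sup_left : _ ≤ P ⊔ Q) (Submodule.subset_span ?_)
          simpa [hzx, hxy] using hx
        · refine (le_sup_of_le_left le_sup_left : _ ≤ P ⊔ Q) (Submodule.subset_span ?_)
          simpa [hzx] using hz
      · rcases Finset.mem_union.mp hj with hj | hj
        · exact le_sup_of_le_left (hP j hj)
        · exact le_sup_of_le_right (hQ j hj)
    have hinf : (I ∩ J).card ≤ finrank K ↥(P ⊓ Q) :=
      (hA _).trans (Submodule.finrank_mono (iSup₂_le fun j hj =>
        le_inf (hP j (Finset.mem_inter.mp hj).1) (hQ j (Finset.mem_inter.mp hj).2)))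
    rw [Finset.card_insert_of_notMem (by simp [hiI, hiJ])] at hsup
    have := Submodule.finrank_sup_add_finrank_inf_eq P Q
    have := Finset.card_union_add_card_inter I J
    omega

/-! ### Rows of the rigidity matrix and the counting bounds -/

section Rows

variable {K X V E R : Type*} [Field K] [AddCommGroup X] [Module K X]

/-- The functional `m ↦ y (m u - m v)`. -/
def edgeRow (u v : V) : Dual K X →ₗ[K] Dual K (V → X) :=
  (LinearMap.proj (R := K) (φ := fun _ : V => X) u - LinearMap.proj v).dualMap

/-- The functional `m ↦ y (m v)`. -/
def vertexRow (v : V) : Dual K X →ₗ[K] Dual K (V → X) :=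
  (LinearMap.proj (R := K) (φ := fun _ : V => X) v).dualMap

@[simp] theorem edgeRow_apply (u v : V) (y : Dual K X) (m : V → X) :
    edgeRow u v y m = y (m u - m v) := rfl

@[simp] theorem vertexRow_apply (v : V) (y : Dual K X) (m : V → X) :
    vertexRow v y m = y (m v) := rfl

/-- The set of end vertices of the edges in `F`. -/
def ends [DecidableEq V] (s t : E → V) (F : Finset E) : Finset V := F.image s ∪ F.image t

variable [DecidableEq V] (s t : E → V)

theorem mem_ends {F : Finset E} {v : V} : v ∈ ends s t F ↔ ∃ e ∈ F, s e = v ∨ t e = v := by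
  simp only [ends, Finset.mem_union, Finset.mem_image]
  grind

variable [FiniteDimensional K X] [Fintype V] [Fintype R] (root : R → V) (y₀ : R → Dual K X)

theorem card_add_card_le_of_linearIndependent (y : E → Dual K X)
    (h : LinearIndependent K (Sum.elim (fun e => edgeRow (s e) (t e) (y e))
      (fun r => vertexRow (root r) (y₀ r)))) (F : Finset E) (hF : F.Nonempty) :
    F.card + (Finset.univ.filter fun r => root r ∈ ends s t F).card + finrank K X ≤
      finrank K X * (ends s t F).card +
        finrank K (Submodule.span K (y₀ '' {r | root r ∈ ends s t F})) := by
  classical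
  set S := Finset.univ.filter fun r => root r ∈ ends s t F
  set U := ends s t F
  set B := Submodule.span K (y₀ '' {r | root r ∈ U})
  set f := Sum.elim (fun e => edgeRow (s e) (t e) (y e)) (fun r => vertexRow (root r) (y₀ r))
  set W : Submodule K (Dual K (V → X)) := Submodule.span K (f '' (F.disjSum S : Finset (E ⊕ R)))
  have hW : finrank K W = F.card + S.card := by
    rw [← Finset.card_disjSum, ← Fintype.card_coe]
    have := finrank_span_eq_card (h.comp (Subtype.val : (F.disjSum S) → E ⊕ R)
      Subtype.val_injective)
    rw [← this, Set.range_comp, Subtype.range_coe_subtype]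
    rfl
  obtain ⟨e₀, he₀⟩ := hF
  have hu₀ : s e₀ ∈ U := (mem_ends s t).mpr ⟨e₀, he₀, Or.inl rfl⟩
  -- Maps free off `U` and constant on `U`, the constant lying in the annihilator of `B`. Since `U`
  -- is non-empty the constant can be read off, so `g` is injective.
  let g : (({v // v ∉ U} → X) × B.dualCoannihilator) →ₗ[K] (V → X) :=
    LinearMap.pi fun v => if hv : v ∈ U then
      B.dualCoannihilator.subtype ∘ₗ LinearMap.snd K _ _
      else LinearMap.proj (⟨v, hv⟩ : {v // v ∉ U}) ∘ₗ LinearMap.fst K _ _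
  have hg1 : ∀ p v, v ∈ U → g p v = p.2 := fun p v hv => by simp [g, hv]
  have hg2 : ∀ p v (hv : v ∉ U), g p v = p.1 ⟨v, hv⟩ := fun p v hv => by simp [g, hv]
  have hgi : Function.Injective g := by
    intro p q hpq
    refine Prod.ext (funext fun v => ?_) (Subtype.ext ?_)
    · rw [← hg2, ← hg2, hpq]
    · rw [← hg1 p _ hu₀, ← hg1 q _ hu₀, hpq]
  have hgr : LinearMap.range g ≤ W.dualCoannihilator := by
    rintro _ ⟨p, rfl⟩
    rw [Submodule.mem_dualCoannihilator]
    intro w hw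
    induction hw using Submodule.span_induction with
    | mem w hw =>
      obtain ⟨i, hi, rfl⟩ := hw
      rcases i with e | r
      · have he : e ∈ F := by simpa using hi
        simp [f, hg1 p _ ((mem_ends s t).mpr ⟨e, he, Or.inl rfl⟩),
          hg1 p _ ((mem_ends s t).mpr ⟨e, he, Or.inr rfl⟩)]
      · have hr : root r ∈ U := by simpa [S] using hi
        simpa [f, hg1 p _ hr] using (Submodule.mem_dualCoannihilator _).mp p.2.2 (y₀ r)
          (Submodule.subset_span ⟨r, hr, rfl⟩)
    | zero => simp
    | add a b _ _ ha hb => simp [ha, hb]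
    | smul c a _ ha => simp [ha]
  have h1 := Submodule.finrank_mono hgr
  rw [LinearMap.finrank_range_of_inj hgi, finrank_prod, finrank_pi_fintype] at h1
  have h2 := Subspace.finrank_add_finrank_dualCoannihilator_eq W
  have h3 := Subspace.finrank_add_finrank_dualCoannihilator_eq B
  rw [finrank_pi_fintype] at h2
  simp only [Finset.sum_const, Finset.card_univ, smul_eq_mul] at h1 h2
  have h4 : Fintype.card {v // v ∉ U} + U.card = Fintype.card V := by
    rw [Fintype.card_subtype_compl, Fintype.card_coe]
    exact Nat.sub_add_cancel (Finset.card_le_univ U)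
  rw [← h4, add_mul, mul_comm U.card] at h2
  omega

/-- The rank of the functionals `y₀ r` with `r ∈ S`. -/
def rankOn (S : Finset R) : ℕ := finrank K (Submodule.span K (y₀ '' (S : Set R)))

omit [Fintype R] in
theorem rankOn_le_add_card_sdiff [DecidableEq R] (S T : Finset R) :
    rankOn y₀ T ≤ rankOn y₀ S + (T \ S).card := by
  have h : Submodule.span K (y₀ '' (T : Set R)) ≤
      Submodule.span K (y₀ '' (S : Set R)) ⊔ Submodule.span K (y₀ '' ((T \ S : Finset R) : Set R)) := by
    rw [← Submodule.span_union, ← Set.image_union]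
    refine Submodule.span_mono (Set.image_mono fun r hr => ?_)
    by_cases h : r ∈ S <;> simp_all
  refine (Submodule.finrank_mono h).trans ((Submodule.finrank_add_le_finrank_add_finrank _ _).trans
    (Nat.add_le_add_left ?_ _))
  classical
  have := finrank_span_finset_le_card (R := K) ((T \ S).image y₀)
  rw [Set.finrank, Finset.coe_image] at this
  exact this.trans Finset.card_image_le

/-- Two vertices are related if they are joined by a path of edges in `F`. -/
def linked (F : Finset E) : Setoid V :=
  Relation.EqvGen.setoid fun u v => ∃ e ∈ F, s e = u ∧ t e = v

omit [Fintype V] in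
theorem eq_or_mem_ends_of_linked (F : Finset E) {u v : V} (h : linked s t F u v) :
    u = v ∨ (u ∈ ends s t F ∧ v ∈ ends s t F) := by
  have h : Relation.EqvGen (fun u v => ∃ e ∈ F, s e = u ∧ t e = v) u v := h
  simp only [mem_ends]
  clear * - h
  induction h with
  | rel u v h => grind
  | refl => simp
  | symm _ _ _ ih => exact ih.imp Eq.symm And.symm
  | trans _ _ _ h _ ih ih' =>
    obtain rfl | ih := ih
    · exact ih'
    · obtain rfl | ih' := ih'
      · exact Or.inr ih
      · exact Or.inr ⟨ih.1, ih'.2⟩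

/-- Rado's condition for the rows. Maps killed by `W` are constant on the components of `F`, with
values annihilated by the boundary functionals of the component. Hence their space has dimension at
most the sum over components of `D - rank`, and this is compared with the counts. -/
theorem card_add_card_le_finrank (A : Finset (Dual K X)) (hA : Submodule.span K (A : Set (Dual K X)) = ⊤)
    (h1 : ∀ v, LinearIndependent K fun r : {r // root r = v} => y₀ r)
    (h2 : ∀ F : Finset E, F.Nonempty →
      F.card + (Finset.univ.filter fun r => root r ∈ ends s t F).card + finrank K X ≤
      finrank K X * (ends s t F).card + rankOn y₀ (Finset.univ.filter fun r => root r ∈ ends s t F))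
    (F : Finset E) (S : Finset R) (W : Submodule K (Dual K (V → X)))
    (hWF : ∀ e ∈ F, ∀ y ∈ A, edgeRow (s e) (t e) y ∈ W)
    (hWS : ∀ r ∈ S, vertexRow (root r) (y₀ r) ∈ W) :
    F.card + S.card ≤ finrank K W := by
  classical
  let Q := Quotient (linked s t F)
  let q : V → Q := Quotient.mk _
  have : Fintype Q := Quotient.fintype _
  have hq : ∀ e ∈ F, q (s e) = q (t e) := fun e he =>
    Quotient.sound (Relation.EqvGen.rel _ _ ⟨e, he, rfl, rfl⟩)
  let Fc (c : Q) := F.filter fun e => q (s e) = c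
  let Sc (c : Q) := S.filter fun r => q (root r) = c
  let Vc (c : Q) := Finset.univ.filter fun v => q v = c
  have hinc : ∀ u v, q u = q v → u ≠ v → u ∈ ends s t (Fc (q u)) := by
    intro u v huv hne
    have h := (eq_or_mem_ends_of_linked s t F (Quotient.exact huv)).resolve_left hne
    obtain ⟨e, he, h⟩ := (mem_ends s t).mp h.1
    refine (mem_ends s t).mpr ⟨e, Finset.mem_filter.mpr ⟨he, ?_⟩, h⟩
    rcases h with rfl | rfl
    · rfl
    · exact hq e he
  -- With edges present, the vertex set of the component is the set of ends of its edges, so `h2`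
  -- applies. Without edges it is a single vertex, and `h1` gives equality.
  have hc : ∀ c, (Fc c).card + (Sc c).card + finrank K X ≤
      finrank K X * (Vc c).card + rankOn y₀ (Sc c) := by
    intro c
    by_cases hF : (Fc c).Nonempty
    · have hends : ends s t (Fc c) = Vc c := by
        ext v
        simp only [Vc, Finset.mem_filter, Finset.mem_univ, true_and]
        constructor
        · rw [mem_ends]
          rintro ⟨e, he, h⟩
          obtain ⟨heF, rfl⟩ := Finset.mem_filter.mp he
          rcases h with rfl | rfl
          · rfl
          · exact (hq e heF).symm
        · rintro rfl
          obtain ⟨e, he⟩ := hF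
          by_cases hev : s e = v
          · exact (mem_ends s t).mpr ⟨e, he, Or.inl hev⟩
          · exact hinc v (s e) (Finset.mem_filter.mp he).2.symm (Ne.symm hev)
      have h := h2 (Fc c) hF
      rw [hends] at h
      set T := Finset.univ.filter fun r => root r ∈ Vc c
      have hST : Sc c ⊆ T := by
        intro r hr
        simpa [T, Vc] using (Finset.mem_filter.mp hr).2
      -- `h2` counts all boundary elements `T` on the component. Dropping those outside `S` lowers
      -- the rank by no more than the cardinality.
      have := rankOn_le_add_card_sdiff y₀ (Sc c) T
      have := Finset.card_sdiff_add_card_eq_card hST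
      omega
    · obtain ⟨v, rfl⟩ := Quotient.exists_rep c
      have hsing : ∀ u, q u = q v → u = v := by
        intro u hu
        by_contra hne
        obtain ⟨e, he, _⟩ := (mem_ends s t).mp (hinc v u hu.symm (Ne.symm hne))
        exact hF ⟨e, he⟩
      have hV : Vc (q v) = {v} := by
        ext u
        simp only [Vc, Finset.mem_filter, Finset.mem_univ, true_and, Finset.mem_singleton]
        exact ⟨hsing u, fun h => h ▸ rfl⟩
      have hS : (Sc (q v)).card = rankOn y₀ (Sc (q v)) := by
        have hr : ∀ r : Sc (q v), root r = v := fun r =>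
          hsing _ (Finset.mem_filter.mp r.2).2
        have := finrank_span_eq_card ((h1 v).comp (fun r : Sc (q v) => (⟨r, hr r⟩ : {r // root r = v}))
          fun a b hab => Subtype.ext (congrArg (fun r : {r // root r = v} => (r : R)) hab))
        rw [Fintype.card_coe] at this
        rw [← this, rankOn, Set.image_eq_range]
        rfl
      have hF : (Fc (q v)).card = 0 := by
        rw [Finset.card_eq_zero]; exact Finset.not_nonempty_iff_eq_empty.mp hF
      change (Fc (q v)).card + (Sc (q v)).card + _ ≤ _ * (Vc (q v)).card + rankOn y₀ (Sc (q v))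
      rw [hV, hF, Finset.card_singleton, ← hS]
      omega
  have hsum := Finset.sum_le_sum fun c (_ : c ∈ Finset.univ) => hc c
  simp only [Finset.sum_add_distrib, ← Finset.mul_sum] at hsum
  rw [← Finset.card_eq_sum_card_fiberwise (f := fun e => q (s e)) (by simp),
    ← Finset.card_eq_sum_card_fiberwise (f := fun r => q (root r)) (by simp),
    ← Finset.card_eq_sum_card_fiberwise (f := q) (by simp)] at hsum
  let Bc (c : Q) := Submodule.span K (y₀ '' (Sc c : Set R))
  let g : W.dualCoannihilator →ₗ[K] (Q → X) :=
    LinearMap.pi (fun c => LinearMap.proj c.out) ∘ₗ W.dualCoannihilator.subtype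
  have hm : ∀ m ∈ W.dualCoannihilator, ∀ u v, q u = q v → m u = m v := by
    intro m hm u v huv
    have h : Relation.EqvGen (fun u v => ∃ e ∈ F, s e = u ∧ t e = v) u v := Quotient.exact huv
    induction h with
    | rel u v h =>
      obtain ⟨e, he, rfl, rfl⟩ := h
      -- All candidate functionals vanish on `m u - m v`, and they span the dual, so the difference
      -- is zero.
      rw [← sub_eq_zero, ← Module.forall_dual_apply_eq_zero_iff K]
      intro y
      have hy : y ∈ Submodule.span K (A : Set (Dual K X)) := hA ▸ Submodule.mem_top
      induction hy using Submodule.span_induction with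
      | mem y hy => exact (Submodule.mem_dualCoannihilator _).mp hm _ (hWF e he y hy)
      | zero => simp
      | add a b _ _ ha hb => rw [LinearMap.add_apply, ha, hb, add_zero]
      | smul c a _ ha => rw [LinearMap.smul_apply, ha, smul_zero]
    | refl => rfl
    | symm u v h ih => exact (ih (Quotient.sound h)).symm
    | trans u v w h h' ih ih' => exact (ih (Quotient.sound h)).trans (ih' (Quotient.sound h'))
  have hgm : ∀ (m : W.dualCoannihilator) v, g m (q v) = m.1 v := fun m v =>
    hm m.1 m.2 _ _ (Quotient.out_eq _)
  have hgB : ∀ m c, g m c ∈ (Bc c).dualCoannihilator := by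
    intro m c
    rw [Submodule.mem_dualCoannihilator]
    intro y hy
    induction hy using Submodule.span_induction with
    | mem y hy =>
      obtain ⟨r, hr, rfl⟩ := hy
      obtain ⟨hr, hrc⟩ := Finset.mem_filter.mp (Finset.mem_coe.mp hr)
      rw [← hrc, hgm]
      exact (Submodule.mem_dualCoannihilator _).mp m.2 _ (hWS r hr)
    | zero => simp
    | add a b _ _ ha hb => rw [LinearMap.add_apply, ha, hb, add_zero]
    | smul c a _ ha => rw [LinearMap.smul_apply, ha, smul_zero]
  let g' : W.dualCoannihilator →ₗ[K] (∀ c, (Bc c).dualCoannihilator) :=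
    LinearMap.pi fun c => (LinearMap.proj c ∘ₗ g).codRestrict _ fun m => hgB m c
  have hg' : Function.Injective g' := by
    intro m n hmn
    refine Subtype.ext (funext fun v => ?_)
    rw [← hgm, ← hgm]
    exact congrArg Subtype.val (congrFun hmn (q v))
  have h3 := LinearMap.finrank_le_finrank_of_injective hg'
  rw [finrank_pi_fintype] at h3
  have h4 := Subspace.finrank_add_finrank_dualCoannihilator_eq W
  rw [finrank_pi_fintype] at h4
  have h5 := Finset.sum_congr rfl fun c (_ : c ∈ (Finset.univ : Finset Q)) =>
    Subspace.finrank_add_finrank_dualCoannihilator_eq (Bc c)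
  rw [Finset.sum_add_distrib] at h5
  simp only [Finset.sum_const, Finset.card_univ, smul_eq_mul] at h4 h5 hsum
  have h6 : ∑ c, rankOn y₀ (Sc c) = ∑ c, finrank K (Bc c) := rfl
  rw [mul_comm (finrank K X)] at hsum
  omega

theorem exists_linearIndependent_rows [Fintype E] (A : Finset (Dual K X))
    (hA : Submodule.span K (A : Set (Dual K X)) = ⊤)
    (h1 : ∀ v, LinearIndependent K fun r : {r // root r = v} => y₀ r)
    (h2 : ∀ F : Finset E, F.Nonempty →
      F.card + (Finset.univ.filter fun r => root r ∈ ends s t F).card + finrank K X ≤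
      finrank K X * (ends s t F).card + rankOn y₀ (Finset.univ.filter fun r => root r ∈ ends s t F)) :
    ∃ y : E → Dual K X, (∀ e, y e ∈ A) ∧
      LinearIndependent K (Sum.elim (fun e => edgeRow (s e) (t e) (y e))
        (fun r => vertexRow (root r) (y₀ r)) : E ⊕ R → Dual K (V → X)) := by
  classical
  obtain ⟨x, hx, hxi⟩ := exists_linearIndependent_transversal (K := K)
    (Sum.elim (fun e => A.image (edgeRow (s e) (t e))) (fun r => {vertexRow (root r) (y₀ r)}) :
      E ⊕ R → Finset (Dual K (V → X))) (fun I => by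
    rw [← Finset.card_toLeft_add_card_toRight]
    refine card_add_card_le_finrank s t root y₀ A hA h1 h2 _ _ _ (fun e he y hy => ?_)
      (fun r hr => ?_)
    · exact Submodule.mem_iSup_of_mem (Sum.inl e) (Submodule.mem_iSup_of_mem
        (Finset.mem_toLeft.mp he) (Submodule.subset_span (by simpa using ⟨y, hy, rfl⟩)))
    · exact Submodule.mem_iSup_of_mem (Sum.inr r) (Submodule.mem_iSup_of_mem
        (Finset.mem_toRight.mp hr) (Submodule.subset_span (by simp))))
  choose y hy hyx using fun e => Finset.mem_image.mp (hx (Sum.inl e))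
  refine ⟨y, hy, ?_⟩
  have hxy : Sum.elim (fun e => edgeRow (s e) (t e) (y e)) (fun r => vertexRow (root r) (y₀ r)) = x := by
    ext1 (e | r)
    · exact hyx e
    · exact (Finset.mem_singleton.mp (hx (Sum.inr r))).symm
  rw [hxy]
  exact hxi

end Rows
-- Minimal rigidity as a basis condition
theorem linearIndependent_and_card_eq_iff {K M ι : Type*} [Field K] [AddCommGroup M] [Module K M]
    [FiniteDimensional K M] [Fintype ι] (f : ι → Dual K M) :
    (LinearIndependent K f ∧ Fintype.card ι = finrank K M) ↔
      (∀ m, (∀ i, f i m = 0) → m = 0) ∧ ∀ i, ¬ ∀ m, (∀ j, j ≠ i → f j m = 0) → m = 0 := by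
  -- In finite dimension, trivial common kernel means spanning the dual; minimal rigidity thus
  -- becomes minimal spanning.
  have key : ∀ S : Set ι, (∀ m, (∀ j ∈ S, f j m = 0) → m = 0) ↔ Submodule.span K (f '' S) = ⊤ := by
    intro S
    have h : ∀ m, (∀ j ∈ S, f j m = 0) ↔ m ∈ (Submodule.span K (f '' S)).dualCoannihilator := by
      intro m
      rw [Submodule.mem_dualCoannihilator]
      refine ⟨fun h w hw => ?_, fun h j hj => h _ (Submodule.subset_span ⟨j, hj, rfl⟩)⟩
      induction hw using Submodule.span_induction with
      | mem w hw => obtain ⟨j, hj, rfl⟩ := hw; exact h j hj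
      | zero => simp
      | add a b _ _ ha hb => simp [ha, hb]
      | smul c a _ ha => simp [ha]
    have h3 := Subspace.finrank_add_finrank_dualCoannihilator_eq (Submodule.span K (f '' S))
    simp only [h, ← Submodule.eq_bot_iff]
    rw [← Submodule.finrank_eq_zero (R := K)]
    refine ⟨fun h => Submodule.eq_top_of_finrank_eq ?_, fun h => ?_⟩
    · rw [Subspace.dual_finrank_eq]
      omega
    · rw [h, finrank_top, Subspace.dual_finrank_eq] at h3
      rw [h]
      omega
  have hall : (∀ m, (∀ i, f i m = 0) → m = 0) ↔ Submodule.span K (Set.range f) = ⊤ := by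
    rw [← Set.image_univ, ← key]; simp
  have hone : ∀ i, (∀ m, (∀ j, j ≠ i → f j m = 0) → m = 0) ↔
      Submodule.span K (f '' (Set.univ \ {i})) = ⊤ := by
    intro i; rw [← key]; simp
  simp only [hall, hone]
  constructor
  · rintro ⟨hli, hcard⟩
    refine ⟨hli.span_eq_top_of_card_eq_finrank' (by rw [hcard, Subspace.dual_finrank_eq]), ?_⟩
    intro i hi
    exact linearIndependent_iff_notMem_span.mp hli i (hi ▸ Submodule.mem_top)
  · rintro ⟨hsp, hmin⟩
    have hli : LinearIndependent K f := by
      rw [linearIndependent_iff_notMem_span]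
      intro i hi
      refine hmin i (top_le_iff.mp (hsp ▸ Submodule.span_le.mpr ?_))
      rintro _ ⟨j, rfl⟩
      obtain rfl | hj := eq_or_ne j i
      · exact hi
      · exact Submodule.subset_span ⟨j, by simpa using hj, rfl⟩
    refine ⟨hli, ?_⟩
    rw [← finrank_span_eq_card hli, hsp, finrank_top, Subspace.dual_finrank_eq]

/-! ### Plücker vectors, the Hodge star and the pairing -/

/-- Decomposable wedges span: those of independent families are multiples of Plücker vectors, the
others vanish. -/
theorem span_range_pluckerVec (k n : ℕ) :
    Submodule.span ℝ (Set.range (pluckerVec : Gr k n → ⋀[ℝ]^k (Vec n))) = ⊤ := by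
  rw [← top_le_iff, ← exteriorPower.ιMulti_span, Submodule.span_le]
  rintro _ ⟨v, rfl⟩
  by_cases hv : LinearIndependent ℝ v
  · let W : Gr k n := ⟨Submodule.span ℝ (Set.range v), by simp [finrank_span_eq_card hv]⟩
    have h : Projectivization.mk ℝ (pluckerVec W) (Projectivization.rep_nonzero _) =
        Projectivization.mk ℝ (exteriorPower.ιMulti ℝ k v) (wedge_ne_zero hv) :=
      (Projectivization.mk_rep _).trans (plucker_eq W hv rfl)
    obtain ⟨a, ha⟩ := (Projectivization.mk_eq_mk_iff' ..).mp h.symm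
    rw [← ha]
    exact Submodule.smul_mem _ _ (Submodule.subset_span ⟨W, rfl⟩)
  · rw [AlternatingMap.map_linearDependent _ _ hv]
    exact Submodule.zero_mem _

theorem complIndex_injective (n k : ℕ) :
    Function.Injective (complIndex : Set.powersetCard (Fin n) k → _) := by
  intro S T h
  have h' := congrArg (fun U : Set.powersetCard (Fin n) (n - k) => (U : Finset (Fin n))) h
  exact Subtype.ext (compl_injective h')

theorem hodgeStar_injective (n k : ℕ) : Function.Injective (hodgeStar n k) := by
  refine LinearMap.injective_of_linearIndependent (extBasis n k).toBasis.span_eq ?_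
  have h : hodgeStar n k ∘ (extBasis n k).toBasis =
      fun S => complSign S • extBasis n (n - k) (complIndex S) :=
    funext fun S => (extBasis n k).toBasis.constr_basis ℝ _ S
  rw [h]
  have h0 : ∀ S : Set.powersetCard (Fin n) k, complSign S ≠ 0 := fun S => by simp [complSign]
  exact ((extBasis n (n - k)).orthonormal.linearIndependent.comp _ (complIndex_injective n k)).units_smul
    (fun S => Units.mk0 _ (h0 S))

/-- The functional `a ↦ ⟨a, c⟩` on `⋀^{d-1} ℝ^{d+1}`. -/
def pairingDual (d : ℕ) : (⋀[ℝ]^2 (Vec (d + 1))) →ₗ[ℝ] Dual ℝ (Screw d) :=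
  (innerₗ (Screw d)).flip ∘ₗ (hodgeStar (d + 1) 2 : _ →ₗ[ℝ] Screw d)

@[simp] theorem pairingDual_apply {d : ℕ} (a : Screw d) (c : ⋀[ℝ]^2 (Vec (d + 1))) :
    pairingDual d c a = pairing a c := rfl

theorem pairingDual_injective (d : ℕ) : Function.Injective (pairingDual d) := by
  intro x y h
  apply hodgeStar_injective
  exact ext_inner_left ℝ fun a => LinearMap.congr_fun h a

theorem finrank_screw {d : ℕ} (hd : 1 ≤ d) : finrank ℝ (Screw d) = (d + 1).choose 2 := by
  rw [exteriorPower.finrank_eq, finrank_euclideanSpace_fin]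
  -- Here `1 ≤ d` matters: at `d = 0`, truncated subtraction would give dimension 1 against a
  -- binomial coefficient 0.
  exact Nat.choose_symm_of_eq_add (by omega)

theorem range_pairingDual {d : ℕ} (hd : 1 ≤ d) : LinearMap.range (pairingDual d) = ⊤ := by
  apply Submodule.eq_top_of_finrank_eq
  rw [LinearMap.finrank_range_of_inj (pairingDual_injective d),
    Subspace.dual_finrank_eq, finrank_screw hd, exteriorPower.finrank_eq, finrank_euclideanSpace_fin]

theorem exists_finset_span_pairingDual {d : ℕ} (hd : 1 ≤ d) : ∃ A : Finset (Dual ℝ (Screw d)),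
    (A : Set (Dual ℝ (Screw d))) ⊆ Set.range (fun W : Gr 2 (d + 1) => pairingDual d (pluckerVec W)) ∧
      Submodule.span ℝ (A : Set (Dual ℝ (Screw d))) = ⊤ := by
  obtain ⟨A, hA, hs⟩ := (Submodule.fg_span_iff_fg_span_finset_subset (R := ℝ)
    (Set.range (fun W : Gr 2 (d + 1) => pairingDual d (pluckerVec W)))).mp
    (IsNoetherian.noetherian _)
  refine ⟨A, hA, hs.symm.trans ?_⟩
  rw [Set.range_comp' (pairingDual d), ← Submodule.map_span, span_range_pluckerVec, Submodule.map_top,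
    range_pairingDual hd]

/-! ### Frameworks as families of rows -/

section Framework

variable {d : ℕ} {α β ρ : Type*}

/-- The rigidity matrix, its rows being functionals on the space of maps `V → ⋀^{d-1} ℝ^{d+1}`. -/
def rigidityRow (P : Framework d α β ρ) (s t : E(P.graph) → V(P.graph)) :
    E(P.graph) ⊕ ρ → Dual ℝ (V(P.graph) → Screw d) :=
  Sum.elim (fun e => edgeRow (s e) (t e) (pairingDual d (pluckerVec (P.bar e))))
    (fun r => vertexRow (P.root r) (pairingDual d (pluckerVec (P.boundaryBar r))))

theorem pairing_sub_eq_zero_comm (a b : Screw d) (c : ⋀[ℝ]^2 (Vec (d + 1))) :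
    pairing (a - b) c = 0 ↔ pairing (b - a) c = 0 := by
  rw [← neg_sub, ← pairingDual_apply, map_neg, neg_eq_zero, pairingDual_apply]

/-- A symmetric condition on the ends of an edge may be tested on one chosen orientation `s`, `t`.
-/
theorem isLink_iff_of_isLink {G : Graph α β} {s t : E(G) → V(G)}
    (hst : ∀ e : E(G), G.IsLink e (s e) (t e)) (e : E(G)) (p : V(G) → V(G) → Prop)
    (hp : ∀ u v, p u v ↔ p v u) : (∀ u v : V(G), G.IsLink e u v → p u v) ↔ p (s e) (t e) := by
  refine ⟨fun h => h _ _ (hst e), fun h u v huv => ?_⟩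
  rcases (hst e).eq_and_eq_or_eq_and_eq huv with ⟨h1, h2⟩ | ⟨h1, h2⟩
  · rwa [← Subtype.ext h1, ← Subtype.ext h2]
  · rwa [← Subtype.ext h1, ← Subtype.ext h2, hp]

theorem isMinimallyInfinitesimallyRigid_iff (hd : 1 ≤ d) (P : Framework d α β ρ)
    [Fintype V(P.graph)] [Fintype E(P.graph)] [Fintype ρ] (s t : E(P.graph) → V(P.graph))
    (hst : ∀ e : E(P.graph), P.graph.IsLink e (s e) (t e)) :
    P.IsMinimallyInfinitesimallyRigid ↔ LinearIndependent ℝ (rigidityRow P s t) ∧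
      Fintype.card E(P.graph) + Fintype.card ρ =
        (d + 1).choose 2 * Fintype.card V(P.graph) := by
  have hcard : finrank ℝ (V(P.graph) → Screw d) = (d + 1).choose 2 * Fintype.card V(P.graph) := by
    rw [finrank_pi_fintype, Finset.sum_const, finrank_screw hd, Finset.card_univ, smul_eq_mul, mul_comm]
  have hedge : ∀ (e : E(P.graph)) (m : V(P.graph) → Screw d),
      (∀ u v : V(P.graph), P.graph.IsLink e u v →
        pairing (m u - m v) (pluckerVec (P.bar e)) = 0) ↔ rigidityRow P s t (Sum.inl e) m = 0 :=
    fun e m => isLink_iff_of_isLink hst e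
      (fun u v => pairing (m u - m v) (pluckerVec (P.bar e)) = 0)
      fun u v => pairing_sub_eq_zero_comm _ _ _
  rw [← hcard, ← Fintype.card_sum, linearIndependent_and_card_eq_iff, Sum.forall]
  refine and_congr (forall_congr' fun m => imp_congr_left ?_)
    (and_congr (forall_congr' fun e => not_congr (forall_congr' fun m => imp_congr_left ?_))
      (forall_congr' fun r => not_congr (forall_congr' fun m => imp_congr_left ?_)))
  · rw [Sum.forall]
    exact and_congr (forall_congr' fun e => hedge e m) Iff.rfl
  · rw [Sum.forall]
    refine and_congr ⟨fun h f hf => (hedge f m).mp fun u v huv => ?_, fun h f u v huv => ?_⟩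
      ⟨fun h r _ => h r, fun h r => h r Sum.inr_ne_inl⟩
    · have hne : (f : β) ∉ ({(e : β)} : Set β) := fun h => hf (congrArg Sum.inl (Subtype.ext h))
      exact h ⟨f, f.2, hne⟩ u v ⟨huv, hne⟩
    · exact (hedge ⟨f, f.2.1⟩ m).mpr (h ⟨f, f.2.1⟩ fun hf =>
        f.2.2 (congrArg Subtype.val (Sum.inl_injective hf))) u v huv.1
  · rw [Sum.forall]
    exact and_congr ⟨fun h e _ => (hedge e m).mp (h e), fun h e => (hedge e m).mpr (h e Sum.inl_ne_inr)⟩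
      ⟨fun h q hq => h ⟨q, fun hqr => hq (congrArg _ hqr)⟩,
        fun h q => h q.1 fun hq => q.2 (Sum.inr_injective hq)⟩

end Framework

/-! ### From sets of edge labels to finite sets of edges -/

section Counting

variable {α β ρ : Type*} {G : Graph α β} {s t : E(G) → V(G)} [DecidableEq V(G)]

theorem incidentVertices_image (hst : ∀ e : E(G), G.IsLink e (s e) (t e)) (F : Finset E(G)) :
    incidentVertices G (Subtype.val '' (F : Set E(G))) = Subtype.val '' (ends s t F : Set V(G)) := by
  ext v
  constructor
  · rintro ⟨_, ⟨e, he, rfl⟩, hv⟩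
    rcases hv.eq_or_eq_of_isLink (hst e) with rfl | rfl
    · exact ⟨_, (mem_ends s t).mpr ⟨e, he, Or.inl rfl⟩, rfl⟩
    · exact ⟨_, (mem_ends s t).mpr ⟨e, he, Or.inr rfl⟩, rfl⟩
  · rintro ⟨v, hv, rfl⟩
    obtain ⟨e, he, rfl | rfl⟩ := (mem_ends s t).mp hv
    · exact ⟨e, ⟨e, he, rfl⟩, (hst e).inc_left⟩
    · exact ⟨e, ⟨e, he, rfl⟩, (hst e).inc_right⟩

theorem rootsOn_image [Fintype ρ] (hst : ∀ e : E(G), G.IsLink e (s e) (t e)) (root : ρ → V(G))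
    (F : Finset E(G)) : rootsOn G root (Subtype.val '' (F : Set E(G))) =
      (Finset.univ.filter fun r => root r ∈ ends s t F : Finset ρ) := by
  ext r
  simp [rootsOn, incidentVertices_image hst]

theorem rankOn_pairingDual {d : ℕ} (c : ρ → ⋀[ℝ]^2 (Vec (d + 1))) (S : Finset ρ) :
    rankOn (fun r => pairingDual d (c r)) S =
      finrank ℝ (Submodule.span ℝ ((fun r => c r) '' (S : Set ρ))) := by
  rw [rankOn, ← Set.image_image (pairingDual d) c, ← Submodule.map_span]
  exact (Submodule.equivMapOfInjective _ (pairingDual_injective d) _).finrank_eq.symm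

theorem forall_sparse_iff {d : ℕ} [Finite E(G)] [Fintype ρ] (hst : ∀ e : E(G), G.IsLink e (s e) (t e))
    (root : ρ → V(G)) (c : ρ → ⋀[ℝ]^2 (Vec (d + 1))) (D : ℕ) :
    (∀ F : Set β, F ⊆ E(G) → F.Nonempty →
      ((F.ncard + (rootsOn G root F).ncard : ℕ) : ℤ) ≤
        (D : ℤ) * ((incidentVertices G F).ncard : ℤ) - (D : ℤ)
          + (finrank ℝ (Submodule.span ℝ ((fun r => c r) '' rootsOn G root F)) : ℤ)) ↔
    ∀ F : Finset E(G), F.Nonempty →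
      F.card + (Finset.univ.filter fun r => root r ∈ ends s t F).card + D ≤ D * (ends s t F).card +
        rankOn (fun r => pairingDual d (c r)) (Finset.univ.filter fun r => root r ∈ ends s t F) := by
  have key : ∀ F : Finset E(G), (((Subtype.val '' (F : Set E(G)) : Set β).ncard +
      (rootsOn G root (Subtype.val '' (F : Set E(G)))).ncard : ℕ) : ℤ) ≤
        (D : ℤ) * ((incidentVertices G (Subtype.val '' (F : Set E(G)))).ncard : ℤ) - (D : ℤ)
          + (finrank ℝ (Submodule.span ℝ
            ((fun r => c r) '' rootsOn G root (Subtype.val '' (F : Set E(G))))) : ℤ) ↔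
      F.card + (Finset.univ.filter fun r => root r ∈ ends s t F).card + D ≤ D * (ends s t F).card +
        rankOn (fun r => pairingDual d (c r)) (Finset.univ.filter fun r => root r ∈ ends s t F) := by
    intro F
    rw [rankOn_pairingDual, rootsOn_image hst, incidentVertices_image hst,
      Set.ncard_image_of_injective _ Subtype.val_injective,
      Set.ncard_image_of_injective _ Subtype.val_injective, Set.ncard_coe_finset,
      Set.ncard_coe_finset, Set.ncard_coe_finset]
    zify
    constructor <;> intro h <;> linarith
  constructor
  · intro h F hF
    refine (key F).mp (h _ ?_ ?_)
    · rintro _ ⟨e, _, rfl⟩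
      exact e.2
    · exact (Finset.coe_nonempty.mpr hF).image _
  · intro h F hFE hF
    have hfin : (Subtype.val ⁻¹' F : Set E(G)).Finite := Set.toFinite _
    have hF' : Subtype.val '' (hfin.toFinset : Set E(G)) = F := by
      rw [hfin.coe_toFinset, Subtype.image_preimage_coe, Set.inter_eq_right.mpr hFE]
    have h' := (key hfin.toFinset).mpr (h _ ?_)
    · rwa [hF'] at h'
    · rw [← Finset.coe_nonempty]
      exact Set.image_nonempty.mp (hF'.symm ▸ hF)

end Counting

end BodyBar
end

/-! ### The theorem -/

theorem mainTheorem5 {α β ρ : Type*} (d : ℕ) (hd : 1 ≤ d) (G : Graph α β)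
    [Finite V(G)] [Finite E(G)] [Finite ρ] (root : ρ → V(G))
    (b₀ : ρ → BodyBar.Gr 2 (d + 1)) :
    (∃ b : E(G) → BodyBar.Gr 2 (d + 1),
      (BodyBar.Framework.mk G root b b₀).IsMinimallyInfinitesimallyRigid) ↔
    (∀ v : V(G), LinearIndependent ℝ
      (fun r : {r : ρ // root r = v} => BodyBar.pluckerVec (b₀ r))) ∧
    (∀ F : Set β, F ⊆ E(G) → F.Nonempty →
      ((F.ncard + (BodyBar.rootsOn G root F).ncard : ℕ) : ℤ) ≤
        ((d + 1).choose 2 : ℤ) * ((BodyBar.incidentVertices G F).ncard : ℤ) - ((d + 1).choose 2 : ℤ)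
          + (Module.finrank ℝ (Submodule.span ℝ
              ((fun r => BodyBar.pluckerVec (b₀ r)) '' BodyBar.rootsOn G root F)) : ℤ)) ∧
    E(G).ncard + Nat.card ρ = (d + 1).choose 2 * V(G).ncard := by
  classical
  have := Fintype.ofFinite V(G)
  have := Fintype.ofFinite E(G)
  have := Fintype.ofFinite ρ
  have hends : ∀ e : E(G), ∃ u v : V(G), G.IsLink e u v := fun e => by
    obtain ⟨u, v, h⟩ := Graph.exists_isLink_of_mem_edgeSet e.2
    exact ⟨⟨u, h.left_mem⟩, ⟨v, h.right_mem⟩, h⟩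
  choose s t hst using hends
  have hD := BodyBar.finrank_screw hd
  rw [BodyBar.forall_sparse_iff hst root (fun r => BodyBar.pluckerVec (b₀ r)),
    ← Nat.card_coe_set_eq, ← Nat.card_coe_set_eq, Nat.card_eq_fintype_card, Nat.card_eq_fintype_card,
    Nat.card_eq_fintype_card]
  have hrigid := fun b : E(G) → BodyBar.Gr 2 (d + 1) =>
    BodyBar.isMinimallyInfinitesimallyRigid_iff hd (BodyBar.Framework.mk G root b b₀) s t hst
  constructor
  · rintro ⟨b, hb⟩
    obtain ⟨hli, hcard⟩ := (hrigid b).mp hb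
    refine ⟨fun v => ?_, fun F hF => ?_, hcard⟩
    -- The boundary rows at `v` are the images of the Plücker vectors under one linear map, so their
    -- independence descends.
    · refine LinearIndependent.of_comp
        ((BodyBar.vertexRow v).comp (BodyBar.pairingDual d)) ?_
      convert hli.comp (fun r : {r : ρ // root r = v} => Sum.inr r.1)
        (Sum.inr_injective.comp Subtype.val_injective) using 1
      funext ⟨r, hr⟩
      subst hr
      rfl
    · rw [← hD]
      refine (BodyBar.card_add_card_le_of_linearIndependent s t root _ _ hli F hF).trans_eq ?_
      rw [BodyBar.rankOn, Finset.coe_filter_univ]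
  · rintro ⟨h1, h2, h3⟩
    obtain ⟨A, hA, hAs⟩ := BodyBar.exists_finset_span_pairingDual hd
    rw [← hD] at h2
    obtain ⟨y, hy, hli⟩ := BodyBar.exists_linearIndependent_rows s t root
      (fun r => BodyBar.pairingDual d (BodyBar.pluckerVec (b₀ r))) A hAs
      (fun v => (h1 v).map' (BodyBar.pairingDual d)
        (LinearMap.ker_eq_bot.mpr (BodyBar.pairingDual_injective d))) h2
    -- Every functional in `A` comes from a 2-plane, so the chosen rows are realised by an actual
    -- bar-configuration.
    choose b hb using fun e => hA (hy e)
    refine ⟨b, (hrigid b).mpr ⟨?_, h3⟩⟩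
    obtain rfl : _ = y := funext hb
    exact hli
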